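/- Let $E$ and $F$ be real Banach lattices, with topological duals $E'$ and $F'$ (ordered by $f\le g$ iff $f(x)\le g(x)$ for all $x\ge 0$, which makes them Banach lattices). For a subset $A$ of a Banach lattice write $\mathrm{Sol}(A)=\{y : |y|\le |x| \text{ for some } x\in A\}$ for its solid hull; a sequence $(x_n)$ is disjoint if $|x_n|\wedge|x_m|=0$ for $n\neq m$. A bounded set $A\subset E$ is disjointly weakly compact if every disjoint sequence in $\mathrm{Sol}(A)$ converges weakly to $0$. A bounded set $A\subset F'$ is disjointly weak$^*$-compact if every disjoint sequence in $\mathrm{Sol}(A)$ converges to $0$ in the weak$^*$ topology. A bounded set $B\subset F$ is limited if every weak$^*$-null sequence in $F'$ converges to $0$ uniformly on $B$. A bounded linear operator $T:E\to F$ is $DW$-limited if $T(A)$ is a limited set for every disjointly weakly compact set $A\subset E$. Theorem. Let $T:E\to F$ be a positive $DW$-limited operator, let $W\subset E$ be disjointly weakly compact, and let $V\subset F'$ be disjointly weak$^*$-compact. Then: 1. For every disjoint sequence $(x_n)$ in $\mathrm{Sol}(W)$, the sequence $(Tx_n)$ converges to zero uniformly on $\mathrm{Sol}(V)$, that is, $\sup_{f\in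 \mathrm{Sol}(V)}|f(Tx_n)|\to 0$. 2. For every $\varepsilon>0$ there is some $u\in E^+$ such that $\langle |f|,\,T[(|x|-u)^+]\rangle<\varepsilon$ for all $x\in W$ and all $f\in V$. -/

import Mathlib

open Filter Topology

/-! ### The dual of a Banach lattice as a vector lattice

Mathlib has no lattice structure on the topological dual of a Banach lattice. The order is the usual
one (`f ≤ g` iff `f x ≤ g x` for every `x ≥ 0`), and the lattice operations are obtained from
the Riesz-Kantorovich formula `f⁺ x = sup {f y | 0 ≤ y ≤ x}` for `x ≥ 0`. -/

namespace BanachLattice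

section Dual

variable {F : Type*} [NormedAddCommGroup F] [NormedSpace ℝ F] [Lattice F] [HasSolidNorm F]
  [IsOrderedAddMonoid F] [IsOrderedModule ℝ F]

/-- The dual order: `f ≤ g` iff `f x ≤ g x` for all `x ≥ 0`. -/
instance dualPartialOrder : PartialOrder (StrongDual ℝ F) where
  le f g := ∀ x : F, 0 ≤ x → f x ≤ g x
  le_refl _ _ _ := le_rfl
  le_trans _ _ _ h₁ h₂ x hx := (h₁ x hx).trans (h₂ x hx)
  le_antisymm f g h₁ h₂ := by
    have key : ∀ x : F, 0 ≤ x → f x = g x := fun x hx => le_antisymm (h₁ x hx) (h₂ x hx)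
    ext x
    rw [← posPart_sub_negPart x, map_sub, map_sub, key _ (posPart_nonneg x),
      key _ (negPart_nonneg x)]

theorem dual_le_iff {f g : StrongDual ℝ F} : f ≤ g ↔ ∀ x : F, 0 ≤ x → f x ≤ g x := Iff.rfl

/-- The supremum of `f` over the order interval `[0, x]`. -/
noncomputable def supOn (f : StrongDual ℝ F) (x : F) : ℝ := sSup (f '' Set.Icc 0 x)

theorem bddAbove_image_Icc (f : StrongDual ℝ F) (x : F) :
    ‖f‖ * ‖x‖ ∈ upperBounds (f '' Set.Icc 0 x) := by
  rintro _ ⟨y, ⟨hy0, hyx⟩, rfl⟩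
  have h1 : ‖y‖ ≤ ‖x‖ := norm_le_norm_of_abs_le_abs (by
    rwa [abs_of_nonneg hy0, abs_of_nonneg (hy0.trans hyx)])
  calc f y ≤ ‖f y‖ := Real.le_norm_self _
    _ ≤ ‖f‖ * ‖y‖ := f.le_opNorm y
    _ ≤ ‖f‖ * ‖x‖ := by gcongr

theorem isLUB_supOn (f : StrongDual ℝ F) {x : F} (hx : 0 ≤ x) :
    IsLUB (f '' Set.Icc 0 x) (supOn f x) :=
  isLUB_csSup ⟨f 0, 0, ⟨le_rfl, hx⟩, rfl⟩ ⟨_, bddAbove_image_Icc f x⟩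

theorem le_supOn (f : StrongDual ℝ F) {x y : F} (hy : 0 ≤ y) (hyx : y ≤ x) : f y ≤ supOn f x :=
  (isLUB_supOn f (hy.trans hyx)).1 ⟨y, ⟨hy, hyx⟩, rfl⟩

theorem supOn_le (f : StrongDual ℝ F) {x : F} (hx : 0 ≤ x) {c : ℝ}
    (h : ∀ y, 0 ≤ y → y ≤ x → f y ≤ c) : supOn f x ≤ c := by
  refine (isLUB_supOn f hx).2 ?_
  rintro _ ⟨y, ⟨h0, h1⟩, rfl⟩
  exact h y h0 h1

theorem supOn_nonneg (f : StrongDual ℝ F) {x : F} (hx : 0 ≤ x) : 0 ≤ supOn f x := by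
  simpa using le_supOn f le_rfl hx

theorem supOn_add (f : StrongDual ℝ F) {a b : F} (ha : 0 ≤ a) (hb : 0 ≤ b) :
    supOn f (a + b) = supOn f a + supOn f b := by
  apply le_antisymm
  · refine supOn_le f (add_nonneg ha hb) fun y hy hyab => ?_
    have h1 : f (y ⊓ a) ≤ supOn f a := le_supOn f (le_inf hy ha) inf_le_right
    have h2 : f (y - y ⊓ a) ≤ supOn f b := by
      refine le_supOn f (sub_nonneg.2 inf_le_left) ?_
      rw [sub_le_comm]
      exact le_inf (sub_le_self _ hb) (sub_le_iff_le_add.2 hyab)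
    rw [map_sub] at h2
    linarith
  · rw [← le_sub_iff_add_le]
    refine supOn_le f ha fun y hy hya => ?_
    rw [le_sub_comm]
    refine supOn_le f hb fun z hz hzb => ?_
    have := le_supOn f (add_nonneg hy hz) (add_le_add hya hzb)
    rw [map_add] at this
    linarith

theorem supOn_smul_le (f : StrongDual ℝ F) {c : ℝ} (hc : 0 < c) {x : F} (hx : 0 ≤ x) :
    supOn f (c • x) ≤ c * supOn f x := by
  refine supOn_le f (smul_nonneg hc.le hx) fun y hy hyx => ?_
  have h1 : c⁻¹ • y ≤ x := by
    have := smul_le_smul_of_nonneg_left hyx (inv_nonneg.2 hc.le)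
    rwa [inv_smul_smul₀ hc.ne'] at this
  have h2 := le_supOn f (smul_nonneg (inv_nonneg.2 hc.le) hy) h1
  rw [map_smul, smul_eq_mul] at h2
  rwa [← inv_mul_le_iff₀ hc]

theorem supOn_smul (f : StrongDual ℝ F) {c : ℝ} (hc : 0 < c) {x : F} (hx : 0 ≤ x) :
    supOn f (c • x) = c * supOn f x := by
  refine le_antisymm (supOn_smul_le f hc hx) ?_
  have h := supOn_smul_le f (inv_pos.2 hc) (smul_nonneg hc.le hx)
  rw [inv_smul_smul₀ hc.ne'] at h
  rwa [← le_inv_mul_iff₀ hc]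

theorem supOn_posPart_sub (f : StrongDual ℝ F) {a b : F} (ha : 0 ≤ a) (hb : 0 ≤ b) :
    supOn f (a - b)⁺ - supOn f (a - b)⁻ = supOn f a - supOn f b := by
  have h : (a - b)⁺ + b = (a - b)⁻ + a := by
    have := posPart_sub_negPart (a - b)
    rw [sub_eq_sub_iff_add_eq_add] at this
    rw [this, add_comm]
  have h' := congrArg (supOn f) h
  rw [supOn_add f (posPart_nonneg _) hb, supOn_add f (negPart_nonneg _) ha] at h'
  linarith

/-- The positive part of a functional: the linear extension of `x ↦ sup {f y | 0 ≤ y ≤ x}`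
from the positive cone to the whole space. -/
noncomputable def dualPos (f : StrongDual ℝ F) : StrongDual ℝ F :=
  LinearMap.mkContinuous
    { toFun := fun x => supOn f x⁺ - supOn f x⁻
      map_add' := fun x y => by
        have h : x + y = (x⁺ + y⁺) - (x⁻ + y⁻) := by
          conv_lhs => rw [← posPart_sub_negPart x, ← posPart_sub_negPart y]
          abel
        rw [h, supOn_posPart_sub f (add_nonneg (posPart_nonneg _) (posPart_nonneg _))
            (add_nonneg (negPart_nonneg _) (negPart_nonneg _)),
          supOn_add f (posPart_nonneg _) (posPart_nonneg _),
          supOn_add f (negPart_nonneg _) (negPart_nonneg _)]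
        ring
      map_smul' := fun c x => by
        simp only [RingHom.id_apply, smul_eq_mul]
        rcases lt_trichotomy c 0 with hc | rfl | hc
        · have h : c • x = (-c) • x⁻ - (-c) • x⁺ := by
            conv_lhs => rw [← posPart_sub_negPart x]
            rw [← smul_sub, neg_smul, ← smul_neg, neg_sub]
          have hc' : 0 < -c := neg_pos.2 hc
          rw [h, supOn_posPart_sub f (smul_nonneg hc'.le (negPart_nonneg _))
              (smul_nonneg hc'.le (posPart_nonneg _)),
            supOn_smul f hc' (negPart_nonneg _), supOn_smul f hc' (posPart_nonneg _)]
          ring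
        · simp
        · have h : c • x = c • x⁺ - c • x⁻ := by
            conv_lhs => rw [← posPart_sub_negPart x]
            rw [smul_sub]
          rw [h, supOn_posPart_sub f (smul_nonneg hc.le (posPart_nonneg _))
              (smul_nonneg hc.le (negPart_nonneg _)),
            supOn_smul f hc (posPart_nonneg _), supOn_smul f hc (negPart_nonneg _)]
          ring }
    ‖f‖ fun x => by
      have bound : ∀ z : F, 0 ≤ z → z ≤ |x| → supOn f z ≤ ‖f‖ * ‖x‖ := fun z hz hzx => by
        refine supOn_le f hz fun y hy hyz => ?_
        refine (bddAbove_image_Icc f |x| ⟨y, ⟨hy, hyz.trans hzx⟩, rfl⟩).trans ?_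
        rw [norm_abs_eq_norm]
      have h1 := bound _ (posPart_nonneg x) (by
        rw [← posPart_add_negPart x]; exact le_add_of_nonneg_right (negPart_nonneg x))
      have h2 := bound _ (negPart_nonneg x) (by
        rw [← posPart_add_negPart x]; exact le_add_of_nonneg_left (posPart_nonneg x))
      have h3 := supOn_nonneg f (posPart_nonneg x)
      have h4 := supOn_nonneg f (negPart_nonneg x)
      simp only [LinearMap.coe_mk, AddHom.coe_mk, Real.norm_eq_abs]
      rw [abs_le]
      constructor <;> linarith

theorem dualPos_apply (f : StrongDual ℝ F) {x : F} (hx : 0 ≤ x) :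
    dualPos f x = sSup (f '' Set.Icc 0 x) := by
  change supOn f x⁺ - supOn f x⁻ = supOn f x
  have h0 : supOn f 0 = 0 :=
    le_antisymm (supOn_le f le_rfl fun y hy hy' => by simp [le_antisymm hy' hy])
      (supOn_nonneg f le_rfl)
  rw [posPart_of_nonneg hx, negPart_of_nonneg hx, h0, sub_zero]

theorem isLUB_dualPos (f : StrongDual ℝ F) : IsLUB {f, 0} (dualPos f) := by
  constructor
  · rintro g (rfl | rfl) x hx
    · rw [dualPos_apply _ hx]
      exact le_supOn _ hx le_rfl
    · rw [dualPos_apply _ hx]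
      exact supOn_nonneg f hx
  · intro g hg x hx
    have h1 : f ≤ g := hg (by simp)
    have h2 : (0 : StrongDual ℝ F) ≤ g := hg (by simp)
    rw [dualPos_apply _ hx]
    refine supOn_le f hx fun y hy hyx => (h1 y hy).trans ?_
    have := h2 (x - y) (sub_nonneg.2 hyx)
    rw [map_sub] at this
    simpa using this

instance dualIsOrderedAddMonoid : IsOrderedAddMonoid (StrongDual ℝ F) where
  add_le_add_left f g h k x hx := by
    simpa using h x hx

/-- The topological dual of a Banach lattice is a vector lattice, with `f ⊔ g = g + (f - g)⁺` and
`f ⊓ g = f - (f - g)⁺`; in particular `|f| = f ⊔ -f` is the modulus of `f`. -/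
noncomputable instance dualLattice : Lattice (StrongDual ℝ F) where
  __ := dualPartialOrder
  sup f g := g + dualPos (f - g)
  inf f g := f - dualPos (f - g)
  le_sup_left f g := sub_le_iff_le_add'.1 ((isLUB_dualPos (f - g)).1 (by simp))
  le_sup_right f g := le_add_of_nonneg_right ((isLUB_dualPos (f - g)).1 (by simp))
  sup_le f g k h1 h2 := by
    rw [← le_sub_iff_add_le']
    refine (isLUB_dualPos (f - g)).2 ?_
    rintro _ (rfl | rfl)
    · exact sub_le_sub_right h1 g
    · exact sub_nonneg.2 h2
  inf_le_left f g := sub_le_self _ ((isLUB_dualPos (f - g)).1 (by simp))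
  inf_le_right f g := sub_le_comm.1 ((isLUB_dualPos (f - g)).1 (by simp))
  le_inf k f g h1 h2 := by
    rw [le_sub_comm]
    refine (isLUB_dualPos (f - g)).2 ?_
    rintro _ (rfl | rfl)
    · exact sub_le_sub_left h2 f
    · exact sub_nonneg.2 h1

end Dual

/-! ### Disjoint sequences, disjointly weakly compact and limited sets

The solid hull of a set is Mathlib's `LatticeOrderedAddCommGroup.solidClosure`. -/

/-- A sequence is disjoint if `|x m| ⊓ |x n| = 0` whenever `m ≠ n`. -/
def DisjointSeq {E : Type*} [AddCommGroup E] [Lattice E] (x : ℕ → E) : Prop :=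
  ∀ m n, m ≠ n → |x m| ⊓ |x n| = 0

/-- A bounded set `A` is disjointly weakly compact if every disjoint sequence in the solid hull
of `A` converges weakly to zero. -/
def DisjointlyWeaklyCompact {E : Type*} [NormedAddCommGroup E] [NormedSpace ℝ E] [Lattice E]
    [IsOrderedAddMonoid E] (A : Set E) : Prop :=
  Bornology.IsBounded A ∧
    ∀ x : ℕ → E, DisjointSeq x → (∀ n, x n ∈ LatticeOrderedAddCommGroup.solidClosure A) →
      Tendsto (fun n => toWeakSpace ℝ E (x n)) atTop (𝓝 0)

/-- A bounded set `A` of functionals is disjointly weak*-compact if every disjoint sequence in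
the solid hull of `A` converges to zero in the weak* topology. -/
def DisjointlyWeakStarCompact {F : Type*} [NormedAddCommGroup F] [NormedSpace ℝ F] [Lattice F]
    [HasSolidNorm F] [IsOrderedAddMonoid F] [IsOrderedModule ℝ F]
    (A : Set (StrongDual ℝ F)) : Prop :=
  Bornology.IsBounded A ∧
    ∀ f : ℕ → StrongDual ℝ F, DisjointSeq f →
      (∀ n, f n ∈ LatticeOrderedAddCommGroup.solidClosure A) →
      Tendsto (fun n => StrongDual.toWeakDual (f n)) atTop (𝓝 0)

/-- A bounded set `A` is limited if every weak*-null sequence of functionals converges to zero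
uniformly on `A`. -/
def IsLimitedSet {X : Type*} [NormedAddCommGroup X] [NormedSpace ℝ X] (A : Set X) : Prop :=
  Bornology.IsBounded A ∧
    ∀ f : ℕ → StrongDual ℝ X, Tendsto (fun n => StrongDual.toWeakDual (f n)) atTop (𝓝 0) →
      TendstoUniformlyOn (fun n x => f n x) (fun _ => 0) atTop A

/-- A bounded operator is DW-limited if it maps disjointly weakly compact sets to limited sets. -/
def IsDWLimited {E X : Type*} [NormedAddCommGroup E] [NormedSpace ℝ E] [Lattice E]
    [IsOrderedAddMonoid E] [NormedAddCommGroup X] [NormedSpace ℝ X] (T : E →L[ℝ] X) : Prop :=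
  ∀ A : Set E, DisjointlyWeaklyCompact A → IsLimitedSet (T '' A)

end BanachLattice

/-!
Both parts rest on the classical disjointification in a Banach lattice: if `(yₙ)` is a bounded
sequence of positive elements and `w = ∑ 2⁻ⁿ yₙ`, then the elements
`(yₙ₊₁ - 4ⁿ ∑_{i ≤ n} yᵢ - 2⁻ⁿ w)⁺` are pairwise disjoint (`disjointSeq_posPart_sub`,
`exists_disjointSeq_posPart_sub`), and they lie in the solid hull of `{yₙ}`.

For the first part (`IsDWLimited.tendstoUniformlyOn_solidClosure`), suppose that `f (T xₙ)` does not
tend to zero uniformly on the solid hull of `V`. Since `|xₙ|` is weakly null, one can select positive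
functionals `fₖ` in that hull and indices `nₖ` such that `fₖ (T |x_{nₖ}|)` stays away from zero while
`4ᵏ ∑_{i ≤ k} fᵢ` is small at `T |x_{nₖ₊₁}|`. The dual `F'` is itself a Banach lattice, and
disjointification there replaces the `fₖ` by a disjoint sequence in the solid hull of `V` that still
stays away from zero at `T |x_{nₖ}|`. That sequence is weak*-null by the hypothesis on `V`, while
`{T |xₙ|}` is a limited set by the hypothesis on `T`: a contradiction.

For the second part (`IsDWLimited.exists_abs_apply_posPart_sub_lt`), if no `u` works for `ε`, one
selects `xₙ ∈ W` and `fₙ ∈ V` with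
`|fₙ₊₁| (T (|xₙ₊₁| - 4ⁿ ∑_{i ≤ n} |xᵢ|)⁺) ≥ ε`. Disjointification in `E` changes the arguments of
`|fₙ₊₁| ∘ T` by at most `2⁻ⁿ w`, and the first part applies to the resulting disjoint sequence.
-/

open LatticeOrderedAddCommGroup

namespace BanachLattice

/-! ### Disjointification -/

section Lattice

variable {E : Type*} [AddCommGroup E] [Lattice E] [IsOrderedAddMonoid E]

theorem DisjointSeq.abs {x : ℕ → E} (hx : DisjointSeq x) : DisjointSeq fun n => |x n| :=
  fun m n hmn => by simpa only [abs_abs] using hx m n hmn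

theorem abs_mem_solidClosure {A : Set E} {x : E} (hx : x ∈ solidClosure A) :
    |x| ∈ solidClosure A := by
  obtain ⟨a, ha, hxa⟩ := hx
  exact ⟨a, ha, by rwa [abs_abs]⟩

end Lattice

section VectorLattice

variable {E : Type*} [AddCommGroup E] [Lattice E] [Module ℝ E] [IsOrderedModule ℝ E]

theorem smul_posPart_le {c : ℝ} (hc : 0 ≤ c) (a : E) : c • a⁺ ≤ (c • a)⁺ := by
  rcases hc.eq_or_lt with rfl | hc
  · simp
  · have h : a⁺ ≤ c⁻¹ • (c • a)⁺ := by
      refine sup_le ?_ (smul_nonneg (inv_nonneg.2 hc.le) (posPart_nonneg _))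
      have := smul_le_smul_of_nonneg_left (le_posPart (c • a)) (inv_nonneg.2 hc.le)
      rwa [inv_smul_smul₀ hc.ne'] at this
    have := smul_le_smul_of_nonneg_left h hc.le
    rwa [smul_inv_smul₀ hc.ne'] at this

variable [IsOrderedAddMonoid E]

theorem inf_eq_zero_of_inf_smul_eq_zero {a b : E} (ha : 0 ≤ a) (hb : 0 ≤ b) {c : ℝ} (hc : 0 < c)
    (hc1 : c ≤ 1) (h : a ⊓ c • b = 0) : a ⊓ b = 0 := by
  have h1 : c • (a ⊓ b) ≤ a ⊓ c • b := by
    refine le_inf ?_ (smul_le_smul_of_nonneg_left inf_le_right hc.le)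
    calc c • (a ⊓ b) ≤ c • a := smul_le_smul_of_nonneg_left inf_le_left hc.le
      _ ≤ (1 : ℝ) • a := smul_le_smul_of_nonneg_right hc1 ha
      _ = a := one_smul _ _
  rw [h] at h1
  refine le_antisymm ?_ (le_inf ha hb)
  have := smul_le_smul_of_nonneg_left h1 (inv_nonneg.2 hc.le)
  rwa [inv_smul_smul₀ hc.ne', smul_zero] at this

/-- For `m < n`, the `m`-th term is at most `(yₘ₊₁ - 2⁻ᵐ w)⁺`, and `4⁻ⁿ` times the `n`-th term is
at most the corresponding negative part, because `4⁻ⁿ yₙ₊₁ ≤ 2⁻ᵐ w`. -/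
theorem disjointSeq_posPart_sub {y : ℕ → E} (hy : ∀ n, 0 ≤ y n) {w : E} (hw : 0 ≤ w)
    (hyw : ∀ n, ((1 / 2 : ℝ) ^ n) • y n ≤ w) :
    DisjointSeq fun n => (y (n + 1) - (4 : ℝ) ^ n • ∑ i ∈ Finset.range (n + 1), y i
      - (1 / 2 : ℝ) ^ n • w)⁺ := by
  have hsum (n : ℕ) : 0 ≤ (4 : ℝ) ^ n • ∑ i ∈ Finset.range (n + 1), y i :=
    smul_nonneg (by positivity) (Finset.sum_nonneg fun i _ => hy i)
  have hpw (n : ℕ) : 0 ≤ (1 / 2 : ℝ) ^ n • w := smul_nonneg (by positivity) hw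
  set v : ℕ → E := fun n => (y (n + 1) - (4 : ℝ) ^ n • ∑ i ∈ Finset.range (n + 1), y i
      - (1 / 2 : ℝ) ^ n • w)⁺ with hv
  have hv0 (n : ℕ) : 0 ≤ v n := posPart_nonneg _
  have key : ∀ m n, m < n → v m ⊓ v n = 0 := by
    intro m n hmn
    have h1 : v m ≤ (y (m + 1) - (1 / 2 : ℝ) ^ m • w)⁺ :=
      posPart_mono (sub_le_sub_right (sub_le_self _ (hsum m)) _)
    have h2 : v n ≤ (y (n + 1) - (4 : ℝ) ^ n • y (m + 1))⁺ := by
      refine posPart_mono ((sub_le_self _ (hpw n)).trans (sub_le_sub_left ?_ _))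
      refine smul_le_smul_of_nonneg_left ?_ (by positivity)
      exact Finset.single_le_sum (f := y) (fun i _ => hy i) (Finset.mem_range.2 (by omega))
    have h3 : ((1 / 4 : ℝ) ^ n) • y (n + 1) ≤ (1 / 2 : ℝ) ^ m • w := by
      have e : (1 / 4 : ℝ) ^ n = (2 * (1 / 2 : ℝ) ^ n) * (1 / 2 : ℝ) ^ (n + 1) := by
        rw [pow_succ, show (1 / 4 : ℝ) = 1 / 2 * (1 / 2) by norm_num, mul_pow]
        ring
      rw [e, mul_smul]
      refine (smul_le_smul_of_nonneg_left (hyw (n + 1)) (by positivity)).trans ?_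
      refine smul_le_smul_of_nonneg_right ?_ hw
      obtain ⟨k, rfl⟩ : ∃ k, n = (m + k) + 1 := ⟨n - m - 1, by omega⟩
      rw [pow_succ, pow_add]
      have : (1 / 2 : ℝ) ^ k ≤ 1 := pow_le_one₀ (by norm_num) (by norm_num)
      have : 0 < (1 / 2 : ℝ) ^ m := by positivity
      nlinarith
    have h4 : ((1 / 4 : ℝ) ^ n) • v n ≤ (y (m + 1) - (1 / 2 : ℝ) ^ m • w)⁻ := by
      refine (smul_le_smul_of_nonneg_left h2 (by positivity)).trans
        ((smul_posPart_le (by positivity) _).trans ?_)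
      rw [smul_sub, smul_smul, ← mul_pow, show (1 / 4 : ℝ) * 4 = 1 by norm_num, one_pow, one_smul,
        ← posPart_neg, neg_sub]
      exact posPart_mono (sub_le_sub_right h3 _)
    refine inf_eq_zero_of_inf_smul_eq_zero (hv0 m) (hv0 n) (c := (1 / 4 : ℝ) ^ n) (by positivity)
      (pow_le_one₀ (by norm_num) (by norm_num)) ?_
    refine le_antisymm ?_ (le_inf (hv0 m) (smul_nonneg (by positivity) (hv0 n)))
    exact (inf_le_inf h1 h4).trans_eq (posPart_inf_negPart_eq_zero _)
  intro m n hmn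
  rw [abs_of_nonneg (hv0 m), abs_of_nonneg (hv0 n)]
  rcases hmn.lt_or_gt with h | h
  · exact key m n h
  · rw [inf_comm]
    exact key n m h

/-- Recursive selection of a sequence whose `n + 1`-st term is chosen in dependence on the positive
element `4ⁿ ∑_{i ≤ n} yᵢ` determined by the preceding terms. -/
theorem exists_seq_of_forall_nonneg {α : Type*} (y : α → E) (hy : ∀ a, 0 ≤ y a)
    (P : E → α → Prop) (h : ∀ u, 0 ≤ u → ∃ a, P u a) :
    ∃ a : ℕ → α, (∀ n, ∃ u, P u (a n)) ∧
      ∀ n, P ((4 : ℝ) ^ n • ∑ i ∈ Finset.range (n + 1), y (a i)) (a (n + 1)) := by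
  have h' : ∀ u : E, ∃ a, 0 ≤ u → P u a := fun u => by
    by_cases hu : 0 ≤ u
    · exact (h u hu).imp fun a ha _ => ha
    · exact (h 0 le_rfl).imp fun a _ hu' => absurd hu' hu
  choose c hc using h'
  -- The second component of the state accumulates the sum of the `y (a i)`.
  let s : ℕ → α × E := fun n => n.rec (c 0, y (c 0))
    fun k p => (c ((4 : ℝ) ^ k • p.2), p.2 + y (c ((4 : ℝ) ^ k • p.2)))
  have hs (n : ℕ) : (s n).2 = ∑ i ∈ Finset.range (n + 1), y (s i).1 := by
    induction n with
    | zero => simp [s]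
    | succ n ih => rw [Finset.sum_range_succ, ← ih]
  have hpos (n : ℕ) : 0 ≤ (4 : ℝ) ^ n • ∑ i ∈ Finset.range (n + 1), y (s i).1 :=
    smul_nonneg (by positivity) (Finset.sum_nonneg fun i _ => hy _)
  have hstep (n : ℕ) :
      P ((4 : ℝ) ^ n • ∑ i ∈ Finset.range (n + 1), y (s i).1) (s (n + 1)).1 := by
    have := hc _ (hpos n)
    rwa [← hs] at this ⊢
  refine ⟨fun n => (s n).1, fun n => ?_, hstep⟩
  cases n with
  | zero => exact ⟨0, hc 0 le_rfl⟩
  | succ n => exact ⟨_, hstep n⟩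

end VectorLattice

section BanachLattice

variable {E : Type*} [NormedAddCommGroup E] [Lattice E] [HasSolidNorm E]

theorem isBounded_solidClosure {A : Set E} (hA : Bornology.IsBounded A) :
    Bornology.IsBounded (solidClosure A) := by
  obtain ⟨C, hC⟩ := hA.exists_norm_le
  refine isBounded_iff_forall_norm_le.2 ⟨C, ?_⟩
  rintro x ⟨a, ha, hxa⟩
  exact (norm_le_norm_of_abs_le_abs hxa).trans (hC a ha)

variable [NormedSpace ℝ E] [IsOrderedAddMonoid E]

theorem DisjointlyWeaklyCompact.mono_solidClosure {A B : Set E} (hA : DisjointlyWeaklyCompact A)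
    (hBA : B ⊆ solidClosure A) : DisjointlyWeaklyCompact B := by
  refine ⟨(isBounded_solidClosure hA.1).subset hBA, fun x hx hxB => hA.2 x hx fun n => ?_⟩
  obtain ⟨b, hb, hxb⟩ := hxB n
  obtain ⟨a, ha, hba⟩ := hBA hb
  exact ⟨a, ha, hxb.trans hba⟩

/-- Disjointification of a bounded sequence of positive elements, with `w = ∑ 2⁻ⁿ yₙ`. -/
theorem exists_disjointSeq_posPart_sub [IsOrderedModule ℝ E] [CompleteSpace E] {y : ℕ → E}
    (hy : ∀ n, 0 ≤ y n) {C : ℝ} (hC : ∀ n, ‖y n‖ ≤ C) :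
    ∃ w : E, 0 ≤ w ∧ DisjointSeq fun n => (y (n + 1)
      - (4 : ℝ) ^ n • ∑ i ∈ Finset.range (n + 1), y i - (1 / 2 : ℝ) ^ n • w)⁺ := by
  have hpos (n : ℕ) : 0 ≤ (1 / 2 : ℝ) ^ n • y n := smul_nonneg (by positivity) (hy n)
  have hs : Summable fun n => (1 / 2 : ℝ) ^ n • y n := by
    refine Summable.of_norm_bounded (g := fun n => (1 / 2 : ℝ) ^ n * C)
      (summable_geometric_two.mul_right C) fun n => ?_
    rw [norm_smul, Real.norm_of_nonneg (by positivity)]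
    exact mul_le_mul_of_nonneg_left (hC n) (by positivity)
  have hw : 0 ≤ ∑' n, (1 / 2 : ℝ) ^ n • y n := tsum_nonneg hpos
  exact ⟨_, hw, disjointSeq_posPart_sub hy hw fun n => hs.le_tsum n fun j _ => hpos j⟩

end BanachLattice

/-! ### The dual as a Banach lattice -/

section Dual

variable {F : Type*} [NormedAddCommGroup F] [NormedSpace ℝ F] [Lattice F] [HasSolidNorm F]
  [IsOrderedAddMonoid F] [IsOrderedModule ℝ F]

theorem abs_dual_apply_le_abs (f : StrongDual ℝ F) {x y : F} (hxy : |x| ≤ y) :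
    |f x| ≤ |f| y := by
  have h (z : F) (hz : 0 ≤ z) : f z ≤ |f| z ∧ -f z ≤ |f| z :=
    ⟨dual_le_iff.1 (le_abs_self f) z hz, dual_le_iff.1 (neg_le_abs f) z hz⟩
  have hy : 0 ≤ |f| (y - |x|) := dual_le_iff.1 (abs_nonneg f) _ (sub_nonneg.2 hxy)
  have h1 := h _ (posPart_nonneg x)
  have h2 := h _ (negPart_nonneg x)
  rw [← posPart_add_negPart x, map_sub, map_add] at hy
  have hx : f x = f x⁺ - f x⁻ := by rw [← map_sub, posPart_sub_negPart]
  rw [hx, abs_le]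
  constructor <;> linarith [h1.1, h1.2, h2.1, h2.2]

/-- Since `|f| = (2f)⁺ - f`, the value `|f| x` is the supremum of `f (2 y - x)` over
`0 ≤ y ≤ x`, and `|2 y - x| ≤ x` for such `y`. -/
theorem abs_dual_apply_le_norm (f : StrongDual ℝ F) {x : F} (hx : 0 ≤ x) :
    |f| x ≤ ‖f‖ * ‖x‖ := by
  have h : |f| x = -f x + supOn (f - -f) x := by
    change (-f + dualPos (f - -f)) x = _
    rw [add_apply, dualPos_apply _ hx]
    rfl
  rw [h, ← le_sub_iff_add_le']
  refine supOn_le _ hx fun y hy hyx => ?_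
  have h1 : |y + y - x| ≤ |x| := by
    rw [abs_of_nonneg hx]
    refine abs_le'.2 ⟨?_, ?_⟩
    · rw [sub_le_iff_le_add]
      exact add_le_add hyx hyx
    · rw [neg_sub]
      exact sub_le_self _ (add_nonneg hy hy)
  have h2 : f (y + y - x) ≤ ‖f‖ * ‖x‖ :=
    (Real.le_norm_self _).trans ((f.le_opNorm _).trans
      (mul_le_mul_of_nonneg_left (norm_le_norm_of_abs_le_abs h1) (norm_nonneg _)))
  rw [map_sub, map_add] at h2
  have h3 : (f - -f) y = f y + f y := by simp
  rw [h3]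
  linarith

instance dualHasSolidNorm : HasSolidNorm (StrongDual ℝ F) where
  solid f g hfg := by
    refine f.opNorm_le_bound (norm_nonneg _) fun x => ?_
    calc ‖f x‖ ≤ |f| |x| := abs_dual_apply_le_abs f le_rfl
      _ ≤ |g| |x| := hfg _ (abs_nonneg x)
      _ ≤ ‖g‖ * ‖|x|‖ := abs_dual_apply_le_norm g (abs_nonneg x)
      _ = ‖g‖ * ‖x‖ := by rw [norm_abs_eq_norm]

instance dualIsOrderedModule : IsOrderedModule ℝ (StrongDual ℝ F) where
  smul_le_smul_of_nonneg_left c hc f g hfg x hx := by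
    simpa using mul_le_mul_of_nonneg_left (hfg x hx) hc
  smul_le_smul_of_nonneg_right f hf c d hcd x hx := by
    simpa using mul_le_mul_of_nonneg_right hcd (hf x hx)

end Dual

/-! ### Positive DW-limited operators -/

section PositiveOperators

variable {E : Type*} [NormedAddCommGroup E] [NormedSpace ℝ E] [Lattice E] [IsOrderedAddMonoid E]
  {F : Type*} [NormedAddCommGroup F] [NormedSpace ℝ F] [Lattice F] [IsOrderedAddMonoid F]

theorem abs_apply_le_apply_abs {T : E →L[ℝ] F} (hT : ∀ x, 0 ≤ x → 0 ≤ T x) (x : E) :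
    |T x| ≤ T |x| := by
  refine abs_le'.2 ⟨?_, ?_⟩
  · have := hT _ (sub_nonneg.2 (le_abs_self x))
    rwa [map_sub, sub_nonneg] at this
  · have := hT _ (sub_nonneg.2 (neg_le_abs x))
    rwa [map_sub, sub_nonneg, map_neg] at this

end PositiveOperators

section Operators

variable {E : Type*} [NormedAddCommGroup E] [NormedSpace ℝ E] [Lattice E] [HasSolidNorm E]
  [IsOrderedAddMonoid E]
  {F : Type*} [NormedAddCommGroup F] [NormedSpace ℝ F] [Lattice F] [HasSolidNorm F]
  [IsOrderedAddMonoid F] [IsOrderedModule ℝ F]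

/-- A disjoint sequence in the solid hull of a disjointly weakly compact set is mapped by a positive
DW-limited operator to a sequence that converges to zero uniformly on the solid hull of any
disjointly weak*-compact set. -/
theorem IsDWLimited.tendstoUniformlyOn_solidClosure [IsOrderedModule ℝ E] {T : E →L[ℝ] F}
    (hT_pos : ∀ x : E, 0 ≤ x → 0 ≤ T x) (hT : IsDWLimited T) {W : Set E}
    (hW : DisjointlyWeaklyCompact W) {V : Set (StrongDual ℝ F)}
    (hV : DisjointlyWeakStarCompact V) {x : ℕ → E} (hx : DisjointSeq x)
    (hxW : ∀ n, x n ∈ solidClosure W) :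
    TendstoUniformlyOn (fun n (f : StrongDual ℝ F) => f (T (x n))) (fun _ => 0) atTop
      (solidClosure V) := by
  have hlim : IsLimitedSet (T '' Set.range fun n => |x n|) :=
    hT _ (hW.mono_solidClosure (Set.range_subset_iff.2 fun n => abs_mem_solidClosure (hxW n)))
  have hnull (f : StrongDual ℝ F) : Tendsto (fun n => f (T |x n|)) atTop (𝓝 0) := by
    have h1 := hW.2 _ hx.abs fun n => abs_mem_solidClosure (hxW n)
    have h2 := (WeakBilin.eval_continuous (topDualPairing ℝ E).flip (f.comp T)).tendsto 0
    have h3 : Tendsto (fun n => f (T |x n|)) atTop (𝓝 (f.comp T 0)) := h2.comp h1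
    rwa [map_zero] at h3
  have hT0 (n : ℕ) : 0 ≤ T |x n| := hT_pos _ (abs_nonneg _)
  rw [Metric.tendstoUniformlyOn_iff]
  by_contra! hcon
  obtain ⟨ε, hε, hfreq⟩ := hcon
  -- A pair consists of an index `n` and a functional `f` that is large at `T (x n)`. For given `u`
  -- the index can be taken so large that `u` is small at `T |x n|`.
  obtain ⟨a, ha, hstep⟩ := exists_seq_of_forall_nonneg
    (fun p : ℕ × StrongDual ℝ F => |p.2|) (fun p => abs_nonneg p.2)
    (fun u p => p.2 ∈ solidClosure V ∧ u (T |x p.1|) < ε / 4 ∧ ε ≤ |p.2| (T |x p.1|))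
    (fun u _ => by
      obtain ⟨n, ⟨f, hf, hfn⟩, hun⟩ :=
        (hfreq.and_eventually ((hnull u).eventually_lt_const
          (show (0 : ℝ) < ε / 4 by positivity))).exists
      refine ⟨(n, f), hf, hun, hfn.trans ?_⟩
      rw [dist_zero_left]
      exact abs_dual_apply_le_abs f (abs_apply_le_apply_abs hT_pos _))
  obtain ⟨C, hC⟩ := (isBounded_solidClosure hV.1).exists_norm_le
  obtain ⟨w, hw, hdisj⟩ := exists_disjointSeq_posPart_sub (y := fun n => |(a n).2|) (C := C)
    (fun n => abs_nonneg _) (fun n => by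
      obtain ⟨u, hu⟩ := ha n
      rw [norm_abs_eq_norm]
      exact hC _ hu.1)
  set S : ℕ → StrongDual ℝ F := fun n => (4 : ℝ) ^ n • ∑ i ∈ Finset.range (n + 1), |(a i).2|
    with hS
  have hS0 (n : ℕ) : 0 ≤ S n :=
    smul_nonneg (by positivity) (Finset.sum_nonneg fun i _ => abs_nonneg _)
  have hgV (n : ℕ) : (|(a (n + 1)).2| - S n - (1 / 2 : ℝ) ^ n • w)⁺ ∈ solidClosure V := by
    obtain ⟨f, hf, hfa⟩ := (hstep n).1
    refine ⟨f, hf, ?_⟩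
    rw [abs_of_nonneg (posPart_nonneg _)]
    refine sup_le ?_ (abs_nonneg _)
    exact ((sub_le_self _ (smul_nonneg (by positivity) hw)).trans (sub_le_self _ (hS0 n))).trans hfa
  have hunif := Metric.tendstoUniformlyOn_iff.1 (hlim.2 _ (hV.2 _ hdisj hgV)) (ε / 4)
    (by positivity)
  obtain ⟨D, hD⟩ := hlim.1.exists_norm_le
  have hpow : Tendsto (fun n : ℕ => (1 / 2 : ℝ) ^ n * (‖w‖ * D)) atTop (𝓝 0) := by
    simpa using (tendsto_pow_atTop_nhds_zero_of_lt_one (r := (1 / 2 : ℝ)) (by norm_num)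
      (by norm_num)).mul_const (‖w‖ * D)
  obtain ⟨n, hn, hn'⟩ := (hunif.and (hpow.eventually_lt_const
    (show (0 : ℝ) < ε / 4 by positivity))).exists
  -- At `z` the disjoint functional is at least `ε - ε / 4 - ε / 4`, yet it is less than `ε / 4`.
  set z : F := T |x (a (n + 1)).1| with hz
  have hzmem : z ∈ T '' Set.range fun n => |x n| := ⟨_, ⟨_, rfl⟩, rfl⟩
  have hz0 : 0 ≤ z := hT0 _
  have h1 := hn z hzmem
  rw [dist_zero_left] at h1
  have h2 := (Real.le_norm_self _).trans_lt h1
  have h3 : |(a (n + 1)).2| z - S n z - (1 / 2 : ℝ) ^ n * w z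
      ≤ (|(a (n + 1)).2| - S n - (1 / 2 : ℝ) ^ n • w)⁺ z :=
    dual_le_iff.1 (le_posPart (|(a (n + 1)).2| - S n - (1 / 2 : ℝ) ^ n • w)) z hz0
  have h4 : w z ≤ ‖w‖ * D := (Real.le_norm_self _).trans ((w.le_opNorm z).trans
    (mul_le_mul_of_nonneg_left (hD z hzmem) (norm_nonneg _)))
  have h5 := mul_le_mul_of_nonneg_left h4 (show (0 : ℝ) ≤ (1 / 2 : ℝ) ^ n by positivity)
  obtain ⟨-, h6, h7⟩ := hstep n
  linarith

/-- A disjointly weakly compact set `W` is contained in the order interval `[-u, u]` up to elements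
whose images under `T` are small uniformly on `V`. -/
theorem IsDWLimited.exists_abs_apply_posPart_sub_lt [IsOrderedModule ℝ E] [CompleteSpace E]
    {T : E →L[ℝ] F} (hT_pos : ∀ x : E, 0 ≤ x → 0 ≤ T x) (hT : IsDWLimited T) {W : Set E}
    (hW : DisjointlyWeaklyCompact W) {V : Set (StrongDual ℝ F)}
    (hV : DisjointlyWeakStarCompact V) {ε : ℝ} (hε : 0 < ε) :
    ∃ u : E, 0 ≤ u ∧ ∀ x ∈ W, ∀ f ∈ V, |f| (T ((|x| - u)⁺)) < ε := by
  by_contra! hcon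
  obtain ⟨a, ha, hstep⟩ := exists_seq_of_forall_nonneg
    (fun p : E × StrongDual ℝ F => |p.1|) (fun p => abs_nonneg p.1)
    (fun u p => p.1 ∈ W ∧ p.2 ∈ V ∧ ε ≤ |p.2| (T ((|p.1| - u)⁺)))
    (fun u hu => by
      obtain ⟨x, hx, f, hf, hxf⟩ := hcon u hu
      exact ⟨(x, f), hx, hf, hxf⟩)
  obtain ⟨C, hC⟩ := hW.1.exists_norm_le
  obtain ⟨D, hD⟩ := hV.1.exists_norm_le
  obtain ⟨w, hw, hdisj⟩ := exists_disjointSeq_posPart_sub (y := fun n => |(a n).1|) (C := C)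
    (fun n => abs_nonneg _) (fun n => by
      obtain ⟨u, hu⟩ := ha n
      rw [norm_abs_eq_norm]
      exact hC _ hu.1)
  set S : ℕ → E := fun n => (4 : ℝ) ^ n • ∑ i ∈ Finset.range (n + 1), |(a i).1| with hS
  have hS0 (n : ℕ) : 0 ≤ S n :=
    smul_nonneg (by positivity) (Finset.sum_nonneg fun i _ => abs_nonneg _)
  have hpw (n : ℕ) : 0 ≤ (1 / 2 : ℝ) ^ n • w := smul_nonneg (by positivity) hw
  have hvW (n : ℕ) : (|(a (n + 1)).1| - S n - (1 / 2 : ℝ) ^ n • w)⁺ ∈ solidClosure W := by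
    refine ⟨_, (hstep n).1, ?_⟩
    rw [abs_of_nonneg (posPart_nonneg _)]
    exact sup_le ((sub_le_self _ (hpw n)).trans (sub_le_self _ (hS0 n))) (abs_nonneg _)
  have hunif := Metric.tendstoUniformlyOn_iff.1
    (hT.tendstoUniformlyOn_solidClosure hT_pos hW hV hdisj hvW) (ε / 4) (by positivity)
  have hpow : Tendsto (fun n : ℕ => (1 / 2 : ℝ) ^ n * (D * ‖T w‖)) atTop (𝓝 0) := by
    simpa using (tendsto_pow_atTop_nhds_zero_of_lt_one (r := (1 / 2 : ℝ)) (by norm_num)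
      (by norm_num)).mul_const (D * ‖T w‖)
  obtain ⟨n, hn, hn'⟩ := (hunif.and (hpow.eventually_lt_const
    (show (0 : ℝ) < ε / 4 by positivity))).exists
  obtain ⟨-, hfV, hge⟩ := hstep n
  set f : StrongDual ℝ F := (a (n + 1)).2 with hf
  set v : E := (|(a (n + 1)).1| - S n - (1 / 2 : ℝ) ^ n • w)⁺ with hv
  have h1 := hn |f| (abs_mem_solidClosure ⟨f, hfV, le_rfl⟩)
  rw [dist_zero_left] at h1
  have h2 : |f| (T v) < ε / 4 := (Real.le_norm_self _).trans_lt h1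
  have h3 : (|(a (n + 1)).1| - S n)⁺ ≤ v + (1 / 2 : ℝ) ^ n • w :=
    sup_le (sub_le_iff_le_add.1 (le_posPart _)) (add_nonneg (posPart_nonneg _) (hpw n))
  have h4 : |f| (T (|(a (n + 1)).1| - S n)⁺) ≤ |f| (T v) + (1 / 2 : ℝ) ^ n * |f| (T w) := by
    have : 0 ≤ |f| (T (v + (1 / 2 : ℝ) ^ n • w - (|(a (n + 1)).1| - S n)⁺)) :=
      dual_le_iff.1 (abs_nonneg f) _ (hT_pos _ (sub_nonneg.2 h3))
    rw [map_sub, map_sub, map_add, map_add, map_smul, map_smul, smul_eq_mul] at this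
    exact sub_nonneg.1 this
  have h5 : |f| (T w) ≤ D * ‖T w‖ := (abs_dual_apply_le_norm f (hT_pos w hw)).trans
    (mul_le_mul_of_nonneg_right (hD f hfV) (norm_nonneg _))
  have h6 := mul_le_mul_of_nonneg_left h5 (show (0 : ℝ) ≤ (1 / 2 : ℝ) ^ n by positivity)
  linarith

end Operators

end BanachLattice

theorem mainTheorem4
    {E : Type*} [NormedAddCommGroup E] [NormedSpace ℝ E] [Lattice E] [HasSolidNorm E]
    [IsOrderedAddMonoid E] [IsOrderedModule ℝ E] [CompleteSpace E]
    {F : Type*} [NormedAddCommGroup F] [NormedSpace ℝ F] [Lattice F] [HasSolidNorm F]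
    [IsOrderedAddMonoid F] [IsOrderedModule ℝ F] [CompleteSpace F]
    (T : E →L[ℝ] F) (hT_pos : ∀ x : E, 0 ≤ x → 0 ≤ T x) (hT : BanachLattice.IsDWLimited T)
    (W : Set E) (hW : BanachLattice.DisjointlyWeaklyCompact W)
    (V : Set (StrongDual ℝ F)) (hV : BanachLattice.DisjointlyWeakStarCompact V) :
    (∀ x : ℕ → E, BanachLattice.DisjointSeq x →
      (∀ n, x n ∈ LatticeOrderedAddCommGroup.solidClosure W) →
      TendstoUniformlyOn (fun n (f : StrongDual ℝ F) => f (T (x n))) (fun _ => 0) atTop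
        (LatticeOrderedAddCommGroup.solidClosure V)) ∧
    (∀ ε : ℝ, 0 < ε → ∃ u : E, 0 ≤ u ∧
      ∀ x ∈ W, ∀ f ∈ V, |f| (T ((|x| - u)⁺)) < ε) :=
  ⟨fun _ hx hxW => hT.tendstoUniformlyOn_solidClosure hT_pos hW hV hx hxW,
    fun _ hε => hT.exists_abs_apply_posPart_sub_lt hT_pos hW hV hε⟩
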